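/- Let $0<r\le 1$, $C_r=\{|\lambda|=r\}$, $I_r=\{|\lambda|<r\}$, $A_r=\{r<|\lambda|<1/r\}$, $\sigma_3=\mathrm{diag}[1,-1]$, $A=\begin{pmatrix}0&1\\1&0\end{pmatrix}$. Loop groups. $\Lambda_r SL_\sigma$ is the group of continuous loops $g:C_r\to SL(2,\mathbb C)$ with $\sigma_3 g(-\lambda)\sigma_3^{-1}=g(\lambda)$. $\Lambda_r^+SL_\sigma$ is the subgroup of those that extend analytically to $I_r$ (continuously up to $C_r$). $\Lambda_r SU_\sigma$ is the subgroup of those that extend analytically to $A_r$ (continuously up to the boundary) with values in $SU(2)$ on $S^1$. $\Lambda_{\mathbb C^*}SU_\sigma$ consists of those that extend holomorphically to $\mathbb C^*$ with values in $SU(2)$ on $S^1$. $U(1)$ denotes the constant loops $\mathrm{diag}[u,\bar u]$, $|u|=1$. Dressing. Let $F_c(w,\lambda)=\exp((w\lambda^{-1}-\bar w\lambda)A)$, $w\in\mathbb C$, be the extended unitary frame of the round cylinder. For $h\in\Lambda_r^+SL_\sigma$ write $F=h\#F_c$ if $F:\mathbb C\to\Lambda_rSU_\sigma$ and $hF_c=FB$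 for some $B:\mathbb C\to\Lambda_r^+SL_\sigma$, where $F,B$ are real analytic in $w$, and $F(0,\cdot)=\mathrm{Id}$. A loop $\chi\in\Lambda_rSU_\sigma$ is a monodromy of $F$ with respect to $\tau_q:w\mapsto w+q$ if $F(w+q,\lambda)=\chi(\lambda)F(w,\lambda)k(w)$ for some smooth $k:\mathbb C\to U(1)$. The frame $F_c$ has the monodromy $\chi_c(\tau_q)=\exp((q\lambda^{-1}-\bar q\lambda)A)$. **Lemma.** Let $q\in\mathbb C^*$, $h\in\Lambda_r^+SL_\sigma$ and $F=h\#F_c$. Let $f_q:C_r\to\mathbb C$ be an odd continuous function with a holomorphic extension to $I_r$ (continuous up to $C_r$), and suppose that $F$ has the monodromy $$h\,\chi_c(\tau_q)\,\exp(f_qA)\,h^{-1}\in\Lambda_{\mathbb C^*}SU_\sigma$$ with respect to $\tau_q$. Then the following are equivalent: (i) $h\,\chi_c(\tau_q)\,h^{-1}\in\Lambda_{\mathbb C^*}SU_\sigma$; (ii) $f_q\equiv 0$; (iii) $hAh^{-1}$ is (the restriction to $C_r$ of) a matrix of rational functions on $\mathbb{CP}^1$ with only simple poles. (No further condition on $q$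 is imposed; in particular every $q\in\mathbb C^*$ with $\sqrt{\bar q}-\sqrt q\notin\pi\mathbb Z$ is covered.) -/

import Mathlib

open Matrix Metric Set
open scoped ComplexConjugate ContDiff

noncomputable section

namespace LoopDressing

/-- Complex `2 × 2` matrices. -/
abbrev Mat2 : Type := Matrix (Fin 2) (Fin 2) ℂ

/-- The circle `C_r = {μ ∈ ℂ : |μ| = r}`. -/
abbrev Circ (r : ℝ) : Type := sphere (0 : ℂ) r

/-- Maps `C_r → gl(2, ℂ)`, with pointwise product and pointwise inverse. -/
abbrev Loop (r : ℝ) : Type := Circ r → Mat2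

/-- `σ₃ = diag[1, -1]`. -/
def sigma3 : Mat2 := !![1, 0; 0, -1]

/-- The off-diagonal matrix `A` with both off-diagonal entries equal to `1`. -/
def matA : Mat2 := !![0, 1; 1, 0]

/-- The twisted `r`-loop group of `SL(2, ℂ)`: loops `g : C_r → SL(2, ℂ)` with
`σ₃ g(-μ) σ₃⁻¹ = g(μ)`. Loops are taken to be continuous; loops that are smooth, of class `H^s`
with `s > 1/2`, or of finite (weighted) Wiener norm are all of this kind. -/
def LambdaSL (r : ℝ) : Set (Loop r) :=
  {g | (∀ i j, Continuous fun μ => g μ i j) ∧ (∀ μ, (g μ).det = 1) ∧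
    ∀ μ, sigma3 * g (-μ) * sigma3⁻¹ = g μ}

/-- The positive loops: those that extend analytically to the disc `I_r = {|μ| < r}` (the
extension being continuous up to `C_r`, where it has the given values). -/
def LambdaPlus (r : ℝ) : Set (Loop r) :=
  {g | g ∈ LambdaSL r ∧ ∃ G : ℂ → Mat2,
    (∀ i j, DiffContOnCl ℂ (fun μ => G μ i j) (ball 0 r)) ∧ ∀ μ : Circ r, G μ = g μ}

/-- The `r`-unitary loops: those that extend analytically to the annulus
`A_r = {r < |μ| < 1/r}` (continuously up to the boundary) and are `SU(2)`-valued on `S¹`. -/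
def LambdaSU (r : ℝ) : Set (Loop r) :=
  {g | g ∈ LambdaSL r ∧ ∃ G : ℂ → Mat2,
    (∀ i j, ContinuousOn (fun μ => G μ i j) {μ | r ≤ ‖μ‖ ∧ ‖μ‖ ≤ 1 / r}) ∧
    (∀ i j, DifferentiableOn ℂ (fun μ => G μ i j) {μ | r < ‖μ‖ ∧ ‖μ‖ < 1 / r}) ∧
    (∀ μ : Circ r, G μ = g μ) ∧
    ∀ μ ∈ sphere (0 : ℂ) 1, G μ ∈ specialUnitaryGroup (Fin 2) ℂ}

/-- The unitary loops that are holomorphic on `ℂ^*` (the intersection of all the groups of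
`s`-unitary loops, `0 < s ≤ 1`), regarded as loops on `C_r`. -/
def LambdaCstarSU (r : ℝ) : Set (Loop r) :=
  {g | g ∈ LambdaSL r ∧ ∃ G : ℂ → Mat2,
    (∀ i j, DifferentiableOn ℂ (fun μ => G μ i j) {0}ᶜ) ∧
    (∀ μ : Circ r, G μ = g μ) ∧
    ∀ μ ∈ sphere (0 : ℂ) 1, G μ ∈ specialUnitaryGroup (Fin 2) ℂ}

/-- A family of loops depending real analytically on `w ∈ ℂ`: every entry is a real analytic map
from `ℂ` to the Banach space of continuous functions on `C_r`. -/
def AnalyticFamily {r : ℝ} (F : ℂ → Loop r) : Prop :=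
  ∀ i j, ∃ φ : ℂ → C(Circ r, ℂ), AnalyticOnNhd ℝ φ univ ∧ ∀ w μ, φ w μ = F w μ i j

/-- The dressing class `[h # F₀]`: all unitary factors `F` of pointwise Iwasawa decompositions
`h F₀ = F B` whose factors are analytic in `w`. -/
def dressingClass {r : ℝ} (h : Loop r) (F₀ : ℂ → Loop r) : Set (ℂ → Loop r) :=
  {F | AnalyticFamily F ∧ (∀ w, F w ∈ LambdaSU r) ∧
    ∃ B : ℂ → Loop r, AnalyticFamily B ∧ (∀ w, B w ∈ LambdaPlus r) ∧
      ∀ w, h * F₀ w = F w * B w}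

/-- `F = h # F₀`: the frame `F` lies in the dressing class of `F₀` under `h` and is normalized
at the base point `0`. -/
def IsDressing {r : ℝ} (h : Loop r) (F₀ F : ℂ → Loop r) : Prop :=
  F ∈ dressingClass h F₀ ∧ F 0 = 1

/-- `χ` is a monodromy of the unitary frame `F` with respect to the translation
`τ_q : w ↦ w + q`: it is a unitary loop and `F(w + q) = χ F(w) k(w)` for a smooth map
`k : ℂ → U(1)`, where `U(1)` is the group of constant loops `diag[u, ū]` with `|u| = 1`. -/
def IsMonodromy {r : ℝ} (F : ℂ → Loop r) (q : ℂ) (χ : Loop r) : Prop :=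
  χ ∈ LambdaSU r ∧ ∃ k : ℂ → ℂ, ContDiff ℝ ∞ k ∧ (∀ w, ‖k w‖ = 1) ∧
    ∀ w μ, F (w + q) μ = χ μ * F w μ * !![k w, 0; 0, conj (k w)]

/-- The extended unitary frame of the round cylinder,
`F_c(w, μ) = exp((w μ⁻¹ - w̄ μ) A)`. -/
def cylinderFrame (r : ℝ) (w : ℂ) : Loop r :=
  fun μ => NormedSpace.exp ((w * (μ : ℂ)⁻¹ - conj w * (μ : ℂ)) • matA)

/-- The monodromy `χ_c(τ_q) = exp((q μ⁻¹ - q̄ μ) A)` of the round cylinder. -/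
def cylinderMonodromy (r : ℝ) (q : ℂ) : Loop r :=
  fun μ => NormedSpace.exp ((q * (μ : ℂ)⁻¹ - conj q * (μ : ℂ)) • matA)

/-- The loop `exp(f A)` for a scalar function `f` on `C_r`. -/
def expLoop {r : ℝ} (f : Circ r → ℂ) : Loop r :=
  fun μ => NormedSpace.exp (f μ • matA)

/-- `f` is an odd continuous function on `C_r` with a holomorphic extension to `I_r`. -/
def IsOddPlus {r : ℝ} (f : Circ r → ℂ) : Prop :=
  Continuous f ∧ (∀ μ, f (-μ) = -f μ) ∧
    ∃ g : ℂ → ℂ, DiffContOnCl ℂ g (ball 0 r) ∧ ∀ μ : Circ r, g μ = f μ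

/-- All poles of the rational function `R` on the Riemann sphere are simple: at finite points the
order of the pole is the multiplicity as a root of the reduced denominator, at infinity it is the
degree of the numerator minus the degree of the denominator. -/
def HasOnlySimplePoles (R : RatFunc ℂ) : Prop :=
  (∀ a : ℂ, R.denom.rootMultiplicity a ≤ 1) ∧ R.num.natDegree ≤ R.denom.natDegree + 1

/-- The loop `g` is (the restriction to `C_r` of) a matrix of rational functions on the Riemann
sphere all of whose poles are simple. -/
def IsRationalWithSimplePoles {r : ℝ} (g : Loop r) : Prop :=
  ∃ R : Matrix (Fin 2) (Fin 2) (RatFunc ℂ), ∀ i j,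
    HasOnlySimplePoles (R i j) ∧
    ∀ μ : Circ r, (R i j).denom.eval (μ : ℂ) ≠ 0 ∧
      g μ i j = (R i j).num.eval (μ : ℂ) / (R i j).denom.eval (μ : ℂ)

end LoopDressing

end

/-! Write x = q/z - q̄z and M = hAh⁻¹. Then M has trace 0 and M² = 1 on C_r, so the given monodromy
is cosh(x+f) + sinh(x+f)M and the one in (i) is cosh x + sinh x · M. On S¹, x is imaginary. Both
implications into (ii) build from f a function on I_r that continues to the unit disc and satisfies
a rigid condition on S¹. It is therefore constant, so f is constant, and oddness makes f zero.

From (i), this function is 2 cosh f: it is the trace of one monodromy times the inverse of the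
other, hence continues to ℂ^* and is real on S¹ (`eq_zero_of_cylinder_conj_mem`). From (iii), it is
exp f: clearing denominators in M shows that sinh(x+f) continues to ℂ^*, so the eigenvalue exp(x+f)
does too. This eigenvalue has modulus one on S¹, and so has exp(-x) (`eq_zero_of_isRational`).

For (ii) ⇒ (iii), f = 0 gives (i), so sinh x · M continues to ℂ^*. The zeros of sinh x with r < |z|
< 1 are finitely many and simple. Those on S¹, of any order, give no pole, since unitarity bounds
the entries of sinh x · M by |sinh x|. A polynomial P thus clears all poles of M in the unit disc,
and M is Hermitian on S¹. If the roots of P are symmetric under reflection in S¹, this symmetry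
makes the entries of PM polynomials (`isRational_of_cylinder_conj_mem`). -/

namespace LoopDressing

open Filter Topology

/-! ### Removability of a circle, and gluing -/

/-- Off a circle around the center, the Cauchy integral reproduces a continuous function on a
closed disc that is holomorphic off that circle. -/
theorem cauchy_integral_eq_of_norm_ne {r R : ℝ} (hr : 0 < r) (hrR : r < R) {f : ℂ → ℂ}
    (hc : ContinuousOn f (closedBall 0 R))
    (hd : ∀ z, ‖z‖ < R → ‖z‖ ≠ r → DifferentiableAt ℂ f z) {z : ℂ} (hz : ‖z‖ < R)
    (hzr : ‖z‖ ≠ r) :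
    (2 * Real.pi * Complex.I : ℂ)⁻¹ • (∮ w in C(0, R), (w - z)⁻¹ • f w) = f z := by
  have hR : 0 < R := hr.trans hrR
  have hzb : z ∈ ball (0 : ℂ) R := by simpa using hz
  have hkc : ContinuousOn (dslope f z) (closedBall 0 R) :=
    (continuousOn_dslope (Filter.mem_of_superset (isOpen_ball.mem_nhds hzb)
      ball_subset_closedBall)).2 ⟨hc, hd z hz hzr⟩
  have hkd : ∀ w, ‖w‖ < R → ‖w‖ ≠ r → w ≠ z → DifferentiableAt ℂ (dslope f z) w := fun w h1 h2 h3 =>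
    (differentiableAt_dslope_of_ne h3).2 (hd w h1 h2)
  -- The exceptional circle is only a boundary here: Cauchy's theorem applies to the closed annulus
  -- and to the closed disc separately, since continuity up to the boundary suffices.
  have e1 : (∮ w in C(0, R), dslope f z w) = ∮ w in C(0, r), dslope f z w := by
    refine Complex.circleIntegral_eq_of_differentiable_on_annulus_off_countable hr hrR.le
      (countable_singleton z) (hkc.mono sdiff_subset) ?_
    rintro w ⟨⟨h1, h2⟩, h3⟩
    simp only [mem_ball, mem_closedBall, dist_zero_right, not_le] at h1 h2
    exact hkd w h1 h2.ne' h3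
  have e2 : (∮ w in C(0, r), dslope f z w) = 0 := by
    refine Complex.circleIntegral_eq_zero_of_differentiable_on_off_countable hr.le
      (countable_singleton z) (hkc.mono (closedBall_subset_closedBall hrR.le)) ?_
    rintro w ⟨h1, h3⟩
    simp only [mem_ball, dist_zero_right] at h1
    exact hkd w (h1.trans hrR) h1.ne h3
  have hne : ∀ w ∈ sphere (0 : ℂ) R, w ≠ z := by
    rintro w hw rfl
    simp only [mem_sphere, dist_zero_right] at hw
    exact hz.ne hw
  have e3 : (∮ w in C(0, R), dslope f z w)
      = ∮ w in C(0, R), ((w - z)⁻¹ • f w - (w - z)⁻¹ * f z) := by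
    refine circleIntegral.integral_congr hR.le fun w hw => ?_
    simp only [dslope_of_ne _ (hne w hw), slope_def_field, smul_eq_mul]
    ring
  have hinv : ContinuousOn (fun w : ℂ => (w - z)⁻¹) (sphere 0 R) :=
    (continuousOn_id.sub continuousOn_const).inv₀ fun w hw => sub_ne_zero.2 (hne w hw)
  have hci : CircleIntegrable (fun w : ℂ => (w - z)⁻¹ • f w) 0 R :=
    (hinv.smul (hc.mono sphere_subset_closedBall)).circleIntegrable hR.le
  have hci' : CircleIntegrable (fun w : ℂ => (w - z)⁻¹ * f z) 0 R :=
    (hinv.mul continuousOn_const).circleIntegrable hR.le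
  have e4 : (∮ w in C(0, R), (w - z)⁻¹ * f z) = (2 * Real.pi * Complex.I) * f z := by
    have := circleIntegral.integral_smul_const (fun w : ℂ => (w - z)⁻¹) (f z) 0 R
    simp only [smul_eq_mul] at this
    rw [this, circleIntegral.integral_sub_inv_of_mem_ball hzb]
  rw [e1, e2, circleIntegral.integral_sub hci hci', e4] at e3
  rw [sub_eq_zero.1 e3.symm, smul_eq_mul, inv_mul_cancel_left₀ Complex.two_pi_I_ne_zero]

/-- A continuous function on a closed disc that is holomorphic off a circle is holomorphic. -/
theorem differentiableOn_ball_of_norm_ne {r R : ℝ} (hr : 0 < r) (hrR : r < R) {f : ℂ → ℂ}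
    (hc : ContinuousOn f (closedBall 0 R))
    (hd : ∀ z, ‖z‖ < R → ‖z‖ ≠ r → DifferentiableAt ℂ f z) :
    DifferentiableOn ℂ f (ball 0 R) := by
  have hR : 0 < R := hr.trans hrR
  set C : ℂ → ℂ := fun z => (2 * Real.pi * Complex.I : ℂ)⁻¹ • (∮ w in C(0, R), (w - z)⁻¹ • f w)
  have hC : DifferentiableOn ℂ C (ball 0 R) := by
    have hci : CircleIntegrable f 0 R :=
      (hc.mono sphere_subset_closedBall).circleIntegrable hR.le
    lift R to NNReal using hR.le
    have := (hasFPowerSeriesOn_cauchy_integral hci (by exact_mod_cast hR)).differentiableOn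
    rwa [Metric.eball_coe] at this
  have hoff : ∀ z, ‖z‖ < R → ‖z‖ ≠ r → C z = f z := fun z h1 h2 =>
    cauchy_integral_eq_of_norm_ne hr hrR hc hd h1 h2
  -- On the circle itself the two functions agree by continuity from inside.
  have hin : EqOn C f (closedBall 0 r) := by
    rw [← closure_ball (0 : ℂ) hr.ne']
    have hsub : closure (ball (0 : ℂ) r) ⊆ ball 0 R := by
      rw [closure_ball (0 : ℂ) hr.ne']
      exact closedBall_subset_ball hrR
    refine EqOn.of_subset_closure (s := ball (0 : ℂ) r) (fun z hz => ?_) (hC.continuousOn.mono hsub)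
      (hc.mono (hsub.trans ball_subset_closedBall)) subset_closure subset_rfl
    have : ‖z‖ < r := by simpa using hz
    exact hoff z (this.trans hrR) this.ne
  refine hC.congr fun z hz => ?_
  have hz' : ‖z‖ < R := by simpa using hz
  by_cases h : ‖z‖ = r
  · exact (hin (by simp [h])).symm
  · exact (hoff z hz' h).symm

/-- Gluing of a holomorphic function on a disc and one on an annulus along the common circle. -/
theorem exists_diffContOnCl_glue {r R : ℝ} (hr : 0 < r) (hrR : r ≤ R) {g G : ℂ → ℂ}
    (hg : DiffContOnCl ℂ g (ball 0 r)) (hGc : ContinuousOn G {z | r ≤ ‖z‖ ∧ ‖z‖ ≤ R})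
    (hGd : DifferentiableOn ℂ G {z | r < ‖z‖ ∧ ‖z‖ < R}) (h : ∀ z, ‖z‖ = r → g z = G z) :
    ∃ p, DiffContOnCl ℂ p (ball 0 R) ∧ (∀ z, ‖z‖ ≤ r → p z = g z) ∧
      ∀ z, r ≤ ‖z‖ → ‖z‖ ≤ R → p z = G z := by
  rcases hrR.eq_or_lt with rfl | hlt
  · exact ⟨g, hg, fun _ _ => rfl, fun z h1 h2 => h z (le_antisymm h2 h1)⟩
  classical
  have hR : 0 < R := hr.trans hlt
  set p : ℂ → ℂ := fun z => if ‖z‖ ≤ r then g z else G z with hp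
  have h1 : ∀ z, ‖z‖ ≤ r → p z = g z := fun z hz => by simp [hp, hz]
  have h2 : ∀ z, r ≤ ‖z‖ → p z = G z := fun z hz => by
    rcases hz.eq_or_lt with h3 | h3
    · rw [h1 z h3.symm.le, h z h3.symm]
    · simp [hp, h3]
  have hc : ContinuousOn p (closedBall 0 R) := by
    have hun : closedBall (0 : ℂ) R = closedBall 0 r ∪ {z | r ≤ ‖z‖ ∧ ‖z‖ ≤ R} := by
      ext z
      simp only [mem_closedBall, dist_zero_right, mem_union, mem_ofPred_eq]
      constructor
      · intro h3
        rcases le_total ‖z‖ r with h4 | h4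
        exacts [Or.inl h4, Or.inr ⟨h4, h3⟩]
      · rintro (h3 | h3)
        exacts [h3.trans hrR, h3.2]
    rw [hun]
    refine ContinuousOn.union_of_isClosed ?_ ?_ isClosed_closedBall
      ((isClosed_le continuous_const continuous_norm).inter
        (isClosed_le continuous_norm continuous_const))
    · exact hg.continuousOn_ball.congr fun z hz => h1 z (by simpa using hz)
    · exact hGc.congr fun z hz => h2 z hz.1
  refine ⟨p, ⟨differentiableOn_ball_of_norm_ne hr hlt hc fun z hzR hzr => ?_, ?_⟩, h1,
    fun z h3 _ => h2 z h3⟩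
  · rcases lt_or_gt_of_ne hzr with h3 | h3
    · have ho : ball (0 : ℂ) r ∈ 𝓝 z := isOpen_ball.mem_nhds (by simpa using h3)
      refine (hg.differentiableOn.differentiableAt ho).congr_of_eventuallyEq ?_
      filter_upwards [ho] with w hw
      exact h1 w (by simpa using (mem_ball.1 hw).le)
    · have ho : {z : ℂ | r < ‖z‖ ∧ ‖z‖ < R} ∈ 𝓝 z :=
        ((isOpen_lt continuous_const continuous_norm).inter
          (isOpen_lt continuous_norm continuous_const)).mem_nhds ⟨h3, hzR⟩
      refine (hGd.differentiableAt ho).congr_of_eventuallyEq ?_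
      filter_upwards [ho] with w hw
      exact h2 w hw.1.le
  · rwa [closure_ball (0 : ℂ) hR.ne']

theorem exists_diffContOnCl_glue_of_punctured {r : ℝ} (hr : 0 < r) (hr1 : r ≤ 1) {g G : ℂ → ℂ}
    (hg : DiffContOnCl ℂ g (ball 0 r)) (hG : DifferentiableOn ℂ G {0}ᶜ)
    (h : ∀ z, ‖z‖ = r → g z = G z) :
    ∃ p, DiffContOnCl ℂ p (ball 0 1) ∧ (∀ z, ‖z‖ ≤ r → p z = g z) ∧
      ∀ z, r ≤ ‖z‖ → ‖z‖ ≤ 1 → p z = G z :=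
  exists_diffContOnCl_glue hr hr1 hg
    (hG.continuousOn.mono fun _ hz => norm_pos_iff.1 (hr.trans_le hz.1))
    (hG.mono fun _ hz => norm_pos_iff.1 (hr.trans hz.1)) h

/-! ### Rigidity in the unit disc -/

theorem eqOn_const_of_exp_eqOn_const {r : ℝ} (hr : 0 < r) {g : ℂ → ℂ}
    (hg : DiffContOnCl ℂ g (ball 0 r)) {c : ℂ} (h : ∀ z, ‖z‖ < r → Complex.exp (g z) = c) :
    ∀ z, ‖z‖ ≤ r → g z = g 0 := by
  have hder : EqOn (deriv g) 0 (ball 0 r) := by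
    intro z hz
    have ho : ball (0 : ℂ) r ∈ 𝓝 z := isOpen_ball.mem_nhds hz
    have hgz := hg.differentiableOn.differentiableAt ho
    have h1 : (fun w => Complex.exp (g w)) =ᶠ[𝓝 z] fun _ => c := by
      filter_upwards [ho] with w hw
      exact h w (by simpa using hw)
    have h2 := h1.deriv_eq
    rw [deriv_cexp hgz, deriv_const] at h2
    simpa [Complex.exp_ne_zero] using h2
  have hb : EqOn g (fun _ => g 0) (ball 0 r) := fun z hz =>
    isOpen_ball.is_const_of_deriv_eq_zero (convex_ball (0 : ℂ) r).isPreconnected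
      hg.differentiableOn hder hz (mem_ball_self hr)
  have := hb.of_subset_closure hg.continuousOn continuousOn_const subset_closure subset_rfl
  intro z hz
  exact this (by rw [closure_ball (0 : ℂ) hr.ne']; simpa using hz)

/-- A zero-free holomorphic function on the disc of modulus one on the circle is constant. -/
theorem eq_const_of_norm_eq_one {f : ℂ → ℂ} (hf : DiffContOnCl ℂ f (ball 0 1))
    (h0 : ∀ z, ‖z‖ ≤ 1 → f z ≠ 0) (h1 : ∀ z, ‖z‖ = 1 → ‖f z‖ = 1) :
    ∀ z, ‖z‖ ≤ 1 → f z = f 0 := by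
  have hcl : closure (ball (0 : ℂ) 1) = closedBall 0 1 := closure_ball 0 one_ne_zero
  have hfr : frontier (ball (0 : ℂ) 1) = sphere 0 1 := frontier_ball 0 one_ne_zero
  have hle : ∀ g : ℂ → ℂ, DiffContOnCl ℂ g (ball 0 1) → (∀ z, ‖z‖ = 1 → ‖g z‖ = 1) →
      ∀ z, ‖z‖ ≤ 1 → ‖g z‖ ≤ 1 := by
    intro g hg hg1 z hz
    refine Complex.norm_le_of_forall_mem_frontier_norm_le isBounded_ball hg ?_
      (by rw [hcl]; simpa using hz)
    intro w hw
    rw [hfr] at hw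
    exact (hg1 w (by simpa using hw)).le
  -- The maximum principle for f and for 1/f gives modulus one on the whole disc.
  have hA := hle f hf h1
  have hB := hle f⁻¹ (hf.inv fun z hz => h0 z (by rw [hcl] at hz; simpa using hz))
    (fun z hz => by simp [h1 z hz])
  have hone : ∀ z, ‖z‖ ≤ 1 → ‖f z‖ = 1 := fun z hz => by
    refine le_antisymm (hA z hz) ?_
    have := hB z hz
    rw [Pi.inv_apply, norm_inv] at this
    exact (inv_le_one₀ (norm_pos_iff.2 (h0 z hz))).1 this
  have := Complex.eqOn_closedBall_of_isMaxOn_norm hf (fun z hz => by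
    have hz' : ‖z‖ ≤ 1 := by simpa using (mem_ball.1 hz).le
    simp [hone z hz', hone 0 (by simp)])
  intro z hz
  exact this (by simpa using hz)

/-- A holomorphic function on the disc that is real on the circle is constant. -/
theorem eq_const_of_conj_eq {f : ℂ → ℂ} (hf : DiffContOnCl ℂ f (ball 0 1))
    (h1 : ∀ z, ‖z‖ = 1 → conj (f z) = f z) : ∀ z, ‖z‖ ≤ 1 → f z = f 0 := by
  have hd : DiffContOnCl ℂ (fun z => f z * Complex.I) (ball 0 1) := by
    have := hf.const_smul Complex.I
    rwa [show Complex.I • f = fun z => f z * Complex.I from funext fun z => mul_comm _ _] at this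
  have he := eq_const_of_norm_eq_one
    (f := fun z => Complex.exp (f z * Complex.I)) (Complex.differentiable_exp.comp_diffContOnCl hd)
    (fun z _ => Complex.exp_ne_zero _) (fun z hz => by
      obtain ⟨x, hx⟩ := Complex.conj_eq_iff_real.1 (h1 z hz)
      rw [hx, Complex.norm_exp_ofReal_mul_I])
  have := eqOn_const_of_exp_eqOn_const one_pos hd fun z hz => he z hz.le
  intro z hz
  exact mul_right_cancel₀ Complex.I_ne_zero (this z hz)

/-- Both f + k and i(f - k) are real on the circle, hence constant. -/
theorem eq_const_of_eq_conj {f k : ℂ → ℂ} (hf : DiffContOnCl ℂ f (ball 0 1))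
    (hk : DiffContOnCl ℂ k (ball 0 1)) (h : ∀ z, ‖z‖ = 1 → f z = conj (k z)) :
    ∀ z, ‖z‖ ≤ 1 → f z = f 0 := by
  have hs := eq_const_of_conj_eq (hf.add hk) (fun z hz => by
    simp [h z hz, add_comm])
  have hd := eq_const_of_conj_eq (f := fun z => Complex.I * (f z - k z))
    ((hf.sub hk).const_smul Complex.I) (fun z hz => by
      simp only [h z hz, map_mul, map_sub, Complex.conj_conj, Complex.conj_I]
      ring)
  intro z hz
  have h1 := hs z hz
  have h2 := mul_left_cancel₀ Complex.I_ne_zero (hd z hz)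
  simp only [Pi.add_apply] at h1
  linear_combination (h1 + h2) / 2

theorem diffContOnCl_dslope {k : ℂ → ℂ} (hk : DiffContOnCl ℂ k (ball 0 1)) :
    DiffContOnCl ℂ (dslope k 0) (ball 0 1) := by
  have hn : ball (0 : ℂ) 1 ∈ 𝓝 0 := ball_mem_nhds _ one_pos
  refine ⟨(Complex.differentiableOn_dslope hn).2 hk.differentiableOn, ?_⟩
  exact (continuousOn_dslope (Filter.mem_of_superset hn subset_closure)).2
    ⟨hk.continuousOn, hk.differentiableOn.differentiableAt hn⟩

/-- If `f = z ^ n * conj k` on the unit circle with `f`, `k` holomorphic in the disc, then `f` is a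
polynomial of degree at most `n`. -/
theorem exists_polynomial_of_eq_pow_mul_conj (n : ℕ) : ∀ {f k : ℂ → ℂ},
    DiffContOnCl ℂ f (ball 0 1) → DiffContOnCl ℂ k (ball 0 1) →
    (∀ z, ‖z‖ = 1 → f z = z ^ n * conj (k z)) →
    ∃ p : Polynomial ℂ, p.natDegree ≤ n ∧ ∀ z, ‖z‖ ≤ 1 → f z = p.eval z := by
  induction n with
  | zero =>
    intro f k hf hk h
    refine ⟨Polynomial.C (f 0), by simp, fun z hz => ?_⟩
    rw [Polynomial.eval_C]
    exact eq_const_of_eq_conj hf hk (fun z hz => by simpa using h z hz) z hz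
  | succ n ih =>
    intro f k hf hk h
    -- Removing the top term lowers n: since z = 1/conj z on the circle, z^(n+1) conj(k - k(0)) =
    -- z^n conj((k - k(0))/z).
    have hpow : DiffContOnCl ℂ (fun z : ℂ => conj (k 0) * z ^ (n + 1)) (ball 0 1) :=
      ((differentiable_const _).mul (differentiable_id.pow _)).diffContOnCl
    obtain ⟨p, hp, hpe⟩ := ih (hf.sub hpow) (diffContOnCl_dslope hk) (fun z hz => by
      have hz0 : z ≠ 0 := norm_pos_iff.1 (by rw [hz]; exact one_pos)
      have hzz : z * conj z = 1 := by simp [Complex.mul_conj, Complex.normSq_eq_norm_sq, hz]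
      have hcz : conj z ≠ 0 := right_ne_zero_of_mul_eq_one hzz
      simp only [Pi.sub_apply, h z hz, dslope_of_ne _ hz0, slope_def_field, sub_zero, map_div₀,
        map_sub]
      field_simp
      linear_combination (z ^ n * (conj (k z) - conj (k 0))) * hzz)
    refine ⟨p + Polynomial.C (conj (k 0)) * Polynomial.X ^ (n + 1), ?_, fun z hz => ?_⟩
    · refine (Polynomial.natDegree_add_le _ _).trans (max_le (hp.trans n.le_succ) ?_)
      exact Polynomial.natDegree_C_mul_X_pow_le _ _
    · have := hpe z hz
      simp only [Pi.sub_apply] at this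
      simp [← this]

/-! ### Identity and cancellation on circles -/

theorem accPt_sphere {r : ℝ} (hr : 0 < r) {z : ℂ} (hz : ‖z‖ = r) :
    AccPt z (𝓟 (sphere (0 : ℂ) r)) := by
  have hpre : IsPreconnected (sphere (0 : ℂ) r) :=
    isPreconnected_sphere (by rw [Complex.rank_real_complex]; norm_num) 0 r
  refine IsPreconnected.preperfect_of_nontrivial ?_ hpre z (by simpa using hz)
  refine ⟨(r : ℂ), by simp [abs_of_pos hr], -(r : ℂ), by simp [abs_of_pos hr], ?_⟩
  intro h
  have h' : (r : ℂ) = 0 := by linear_combination h / 2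
  exact hr.ne' (by exact_mod_cast h')

theorem frequently_sphere {r : ℝ} (hr : 0 < r) {z : ℂ} (hz : ‖z‖ = r) :
    ∃ᶠ w in 𝓝[≠] z, ‖w‖ = r := by
  simpa using accPt_iff_frequently_nhdsNE.1 (accPt_sphere hr hz)

theorem isPreconnected_compl_zero : IsPreconnected ({0}ᶜ : Set ℂ) :=
  (isConnected_compl_singleton_of_one_lt_rank
    (by rw [Complex.rank_real_complex]; norm_num) 0).isPreconnected

theorem analyticOnNhd_compl_zero {f : ℂ → ℂ} (hf : DifferentiableOn ℂ f {0}ᶜ) :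
    AnalyticOnNhd ℂ f {0}ᶜ := hf.analyticOnNhd isOpen_compl_singleton

/-- Holomorphic functions on `ℂ^*` that agree on a circle are equal. -/
theorem eq_of_eq_on_sphere {r : ℝ} (hr : 0 < r) {f g : ℂ → ℂ} (hf : DifferentiableOn ℂ f {0}ᶜ)
    (hg : DifferentiableOn ℂ g {0}ᶜ) (h : ∀ z, ‖z‖ = r → f z = g z) :
    ∀ z, z ≠ 0 → f z = g z := by
  have hn : ‖(r : ℂ)‖ = r := by simp [abs_of_pos hr]
  have := (analyticOnNhd_compl_zero hf).eqOn_of_preconnected_of_frequently_eq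
    (analyticOnNhd_compl_zero hg) isPreconnected_compl_zero (z₀ := (r : ℂ))
    (norm_pos_iff.1 (hn.symm ▸ hr)) ((frequently_sphere hr hn).mono h)
  exact fun z hz => this hz

/-- Cancellation on a circle of a factor with isolated zeros. -/
theorem eq_of_mul_eq_on_sphere {r : ℝ} (hr : 0 < r) {S u v : ℂ → ℂ}
    (hS : ∀ a, ‖a‖ = r → ∀ᶠ z in 𝓝[≠] a, S z ≠ 0) (hu : ContinuousOn u (sphere 0 r))
    (hv : ContinuousOn v (sphere 0 r)) (h : ∀ z, ‖z‖ = r → S z * u z = S z * v z) :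
    ∀ z, ‖z‖ = r → u z = v z := by
  intro a ha
  have hs : a ∈ sphere (0 : ℂ) r := by simpa using ha
  have hne : (𝓝[≠] a ⊓ 𝓟 (sphere (0 : ℂ) r)).NeBot := accPt_sphere hr ha
  have hl : 𝓝[≠] a ⊓ 𝓟 (sphere (0 : ℂ) r) ≤ 𝓝[sphere (0 : ℂ) r] a :=
    inf_le_inf_right _ nhdsWithin_le_nhds
  refine tendsto_nhds_unique_of_eventuallyEq ((hu a hs).mono_left hl) ((hv a hs).mono_left hl) ?_
  filter_upwards [Filter.mem_inf_of_left (hS a ha), Filter.mem_inf_of_right (mem_principal_self _)]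
    with z h1 h2
  exact mul_left_cancel₀ h1 (h z (by simpa using h2))

/-! ### Conjugates of exp(xA) and special unitary matrices -/

theorem exp_smul_matA (x : ℂ) :
    NormedSpace.exp (x • matA) = Complex.cosh x • (1 : Mat2) + Complex.sinh x • matA := by
  -- The columns are eigenvectors of `matA` for the eigenvalues 1 and -1.
  set P : Mat2 := !![1, 1; 1, -1] with hP
  have hdet : P.det = -2 := by simp [hP, det_fin_two]; norm_num
  have hu : IsUnit P.det := by rw [hdet]; exact isUnit_iff_ne_zero.2 (by norm_num)
  have hU : IsUnit P := (isUnit_iff_isUnit_det P).2 hu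
  have e1 : x • matA * P = P * diagonal ![x, -x] := by
    ext i j
    fin_cases i <;> fin_cases j <;> simp [hP, matA, mul_apply, Fin.sum_univ_two, Matrix.diagonal]
  have e2 : x • matA = P * diagonal ![x, -x] * P⁻¹ := by
    rw [← e1, mul_nonsing_inv_cancel_right _ _ hu]
  have e3 : NormedSpace.exp (x • matA) * P = P * diagonal (NormedSpace.exp ![x, -x]) := by
    rw [e2, Matrix.exp_conj _ _ hU, Matrix.exp_diagonal, nonsing_inv_mul_cancel_right _ _ hu]
  have e4 : (Complex.cosh x • (1 : Mat2) + Complex.sinh x • matA) * P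
      = P * diagonal (NormedSpace.exp ![x, -x]) := by
    have h1 : Complex.cosh x + Complex.sinh x = Complex.exp x := Complex.cosh_add_sinh x
    have h2 : Complex.cosh x - Complex.sinh x = Complex.exp (-x) := Complex.cosh_sub_sinh x
    have h3 : NormedSpace.exp ![x, -x] = ![Complex.exp x, Complex.exp (-x)] := by
      funext i
      rw [Pi.coe_exp]
      fin_cases i <;> simp [Complex.exp_eq_exp_ℂ]
    rw [hP, h3]
    ext i j
    fin_cases i <;> fin_cases j <;>
      simp [matA, mul_apply, Fin.sum_univ_two, Matrix.diagonal]
    · linear_combination h2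
    · linear_combination -h2
  rw [← mul_nonsing_inv_cancel_right P (NormedSpace.exp (x • matA)) hu, e3, ← e4,
    mul_nonsing_inv_cancel_right _ _ hu]

theorem exp_smul_matA_mul (x y : ℂ) : NormedSpace.exp (x • matA) * NormedSpace.exp (y • matA)
    = Complex.cosh (x + y) • (1 : Mat2) + Complex.sinh (x + y) • matA := by
  rw [exp_smul_matA, exp_smul_matA, Complex.cosh_add, Complex.sinh_add]
  ext i j
  fin_cases i <;> fin_cases j <;> simp [matA, mul_apply, Fin.sum_univ_two] <;> ring

theorem conj_cosh_add_sinh {H : Mat2} (hH : H.det = 1) (c s : ℂ) :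
    H * (c • (1 : Mat2) + s • matA) * H⁻¹ = c • (1 : Mat2) + s • (H * matA * H⁻¹) := by
  have hu : IsUnit H.det := by simp [hH]
  simp only [mul_add, add_mul, Matrix.mul_smul, Matrix.smul_mul, mul_one, mul_nonsing_inv _ hu]

theorem smul_one_add_smul_apply (c s : ℂ) (M : Mat2) (i j : Fin 2) :
    (c • (1 : Mat2) + s • M) i j = c * (if i = j then 1 else 0) + s * M i j := by
  simp [Matrix.one_apply]

theorem conj_matA_eq {H : Mat2} (hH : H.det = 1) : H * matA * H⁻¹ = H * matA * H.adjugate := by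
  rw [inv_def, hH]; simp

theorem conj_matA_trace {H : Mat2} (hH : H.det = 1) :
    (H * matA * H⁻¹) 1 1 = -(H * matA * H⁻¹) 0 0 := by
  rw [conj_matA_eq hH]
  simp [mul_apply, Fin.sum_univ_two, matA, adjugate_fin_two]
  ring

/-- This is the upper left entry of (HAH⁻¹)² = HA²H⁻¹ = 1. -/
theorem conj_matA_sq {H : Mat2} (hH : H.det = 1) :
    (H * matA * H⁻¹) 0 0 * (H * matA * H⁻¹) 0 0
      + (H * matA * H⁻¹) 0 1 * (H * matA * H⁻¹) 1 0 = 1 := by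
  have h2 : H 0 0 * H 1 1 - H 0 1 * H 1 0 = 1 := by rw [← hH, det_fin_two]
  rw [conj_matA_eq hH]
  simp [mul_apply, Fin.sum_univ_two, matA, adjugate_fin_two]
  linear_combination (H 0 0 * H 1 1 - H 0 1 * H 1 0 + 1) * h2

/-- The exponent of the cylinder frame at a point `z` of `ℂ^*`. -/
noncomputable def cylExp (q z : ℂ) : ℂ := q * z⁻¹ - conj q * z

theorem monodromy_apply {r : ℝ} {q : ℂ} {h : Loop r} {f : Circ r → ℂ} {μ : Circ r}
    (hh : (h μ).det = 1) :
    (h * cylinderMonodromy r q * expLoop f * h⁻¹) μ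
      = Complex.cosh (cylExp q μ + f μ) • (1 : Mat2)
        + Complex.sinh (cylExp q μ + f μ) • (h μ * matA * (h μ)⁻¹) := by
  rw [← conj_cosh_add_sinh hh, ← exp_smul_matA_mul, ← mul_assoc]
  rfl

theorem cylinder_conj_apply {r : ℝ} {q : ℂ} {h : Loop r} {μ : Circ r}
    (hh : (h μ).det = 1) :
    (h * cylinderMonodromy r q * h⁻¹) μ
      = Complex.cosh (cylExp q μ) • (1 : Mat2)
        + Complex.sinh (cylExp q μ) • (h μ * matA * (h μ)⁻¹) := by
  rw [← conj_cosh_add_sinh hh, ← exp_smul_matA]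
  rfl

theorem expLoop_eq_one {r : ℝ} {f : Circ r → ℂ} (hf : ∀ μ, f μ = 0) : expLoop f = 1 := by
  funext μ
  simp [expLoop, hf μ]

/-- The adjoint and the adjugate of U are both its inverse. -/
theorem specialUnitary_entries {U : Mat2} (hU : U ∈ specialUnitaryGroup (Fin 2) ℂ) :
    U 1 1 = conj (U 0 0) ∧ U 1 0 = -conj (U 0 1) ∧
      U 0 0 * conj (U 0 0) + U 0 1 * conj (U 0 1) = 1 := by
  obtain ⟨h1, h2⟩ := mem_specialUnitaryGroup_iff.1 hU
  have h3 : star U * U = 1 := mem_unitaryGroup_iff'.1 h1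
  have h4 : star U = U.adjugate := by
    calc star U = star U * (U * U.adjugate) := by rw [mul_adjugate, h2, one_smul, mul_one]
      _ = U.adjugate := by rw [← mul_assoc, h3, one_mul]
  have h5 := congrFun (congrFun h4 0) 0
  have h6 := congrFun (congrFun h4 1) 0
  simp only [star_apply, adjugate_fin_two, of_apply, cons_val_zero, cons_val_one,
    cons_val', cons_val_fin_one] at h5 h6
  have h5' : U 1 1 = conj (U 0 0) := h5.symm
  have h6' : U 1 0 = -conj (U 0 1) := by
    rw [show conj (U 0 1) = -U 1 0 from h6, neg_neg]
  refine ⟨h5', h6', ?_⟩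
  rw [det_fin_two, h5', h6'] at h2
  linear_combination h2

/-! ### The exponent on the unit circle, and odd functions -/

theorem differentiableOn_cylExp (q : ℂ) : DifferentiableOn ℂ (cylExp q) {0}ᶜ := by
  intro z hz
  have hz' : z ≠ 0 := hz
  unfold cylExp
  exact (((differentiableAt_id.inv hz').const_mul q).sub
    (differentiableAt_id.const_mul (conj q))).differentiableWithinAt

/-- As 1/z = conj z, the exponent is a number minus its own conjugate. -/
theorem conj_cylExp (q : ℂ) {z : ℂ} (hz : ‖z‖ = 1) : conj (cylExp q z) = -cylExp q z := by
  have h : z⁻¹ = conj z := by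
    rw [Complex.inv_def, Complex.normSq_eq_norm_sq, hz]; simp
  simp [cylExp, h]

/-- Oddness is known only on the circle; the maximum principle applied to g(z) + g(-z) carries it to
the center. -/
theorem IsOddPlus.extension_zero {r : ℝ} (hr : 0 < r) {f : Circ r → ℂ}
    (hodd : ∀ μ, f (-μ) = -f μ) {g : ℂ → ℂ} (hg : DiffContOnCl ℂ g (ball 0 r))
    (hgf : ∀ μ : Circ r, g μ = f μ) : g 0 = 0 := by
  have hneg : DiffContOnCl ℂ (fun z => g (-z)) (ball 0 r) :=
    hg.comp (g := fun z : ℂ => -z) differentiable_neg.diffContOnCl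
      (fun z hz => by simpa only [mem_ball_zero_iff, norm_neg] using hz)
  have hsum : ∀ z ∈ frontier (ball (0 : ℂ) r), ‖g z + g (-z)‖ ≤ 0 := by
    intro z hz
    rw [frontier_ball (0 : ℂ) hr.ne'] at hz
    have h1 := hgf ⟨z, hz⟩
    have h2 := hgf (-⟨z, hz⟩)
    rw [hodd, ← h1] at h2
    have h3 : g (-z) = -g z := h2
    simp [h3]
  have := Complex.norm_le_of_forall_mem_frontier_norm_le isBounded_ball (hg.add hneg) hsum
    (subset_closure (mem_ball_self hr))
  have h0 : g 0 + g (-0) = 0 := norm_le_zero_iff.1 this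
  rw [neg_zero] at h0
  linear_combination h0 / 2

theorem IsOddPlus.eq_zero_of_exp_eq_const {r : ℝ} (hr : 0 < r) {f : Circ r → ℂ}
    (hodd : ∀ μ, f (-μ) = -f μ) {g : ℂ → ℂ} (hg : DiffContOnCl ℂ g (ball 0 r))
    (hgf : ∀ μ : Circ r, g μ = f μ) {c : ℂ} (hc : ∀ z, ‖z‖ < r → Complex.exp (g z) = c) :
    ∀ μ, f μ = 0 := by
  intro μ
  rw [← hgf, eqOn_const_of_exp_eqOn_const hr hg hc μ (mem_sphere_zero_iff_norm.1 μ.2).le,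
    IsOddPlus.extension_zero hr hodd hg hgf]

/-! ### From (i) to (ii) -/

/-- If both monodromies are unitary and holomorphic on `ℂ^*`, then `2 cosh f` is the trace of their
quotient, hence constant. -/
theorem eq_zero_of_cylinder_conj_mem {r : ℝ} (hr0 : 0 < r) (hr1 : r ≤ 1) {q : ℂ}
    {h : Loop r} (hh : ∀ μ, (h μ).det = 1) {f : Circ r → ℂ} (hf : IsOddPlus f)
    (hunit : h * cylinderMonodromy r q * expLoop f * h⁻¹ ∈ LambdaCstarSU r)
    (hcyl : h * cylinderMonodromy r q * h⁻¹ ∈ LambdaCstarSU r) : ∀ μ, f μ = 0 := by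
  obtain ⟨-, hodd, g, hg, hgf⟩ := hf
  obtain ⟨-, G, hGd, hGe, hGu⟩ := hunit
  obtain ⟨-, K, hKd, hKe, hKu⟩ := hcyl
  -- The trace of G · adj K, where adj K stands for the inverse of K.
  set T : ℂ → ℂ := fun z => G z 0 0 * K z 1 1 - G z 0 1 * K z 1 0 - G z 1 0 * K z 0 1
    + G z 1 1 * K z 0 0 with hT
  have hTd : DifferentiableOn ℂ T {0}ᶜ :=
    ((((hGd 0 0).mul (hKd 1 1)).sub ((hGd 0 1).mul (hKd 1 0))).sub
      ((hGd 1 0).mul (hKd 0 1))).add ((hGd 1 1).mul (hKd 0 0))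
  have hcosh : Differentiable ℂ fun z : ℂ => 2 * Complex.cosh z :=
    (differentiable_const _).mul Complex.differentiable_cosh
  obtain ⟨p, hp, hpg, hpT⟩ := exists_diffContOnCl_glue_of_punctured hr0 hr1
    (hcosh.comp_diffContOnCl hg) hTd (fun z hz => by
      have hz' : z ∈ sphere (0 : ℂ) r := by simpa using hz
      have e1 := hGe ⟨z, hz'⟩
      have e2 := hKe ⟨z, hz'⟩
      have e3 := hgf ⟨z, hz'⟩
      rw [monodromy_apply (hh _)] at e1
      rw [cylinder_conj_apply (hh _)] at e2
      have ht := conj_matA_trace (hh ⟨z, hz'⟩)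
      have hs := conj_matA_sq (hh ⟨z, hz'⟩)
      simp only [← e3] at e1 e2
      simp only at e1 e2 ht hs e3
      simp only [hT, e1, e2, smul_one_add_smul_apply, ht, Function.comp, if_true, Fin.reduceEq,
        if_false]
      have hcs := Complex.cosh_sub (cylExp q z + g z) (cylExp q z)
      rw [add_sub_cancel_left] at hcs
      rw [hcs]
      linear_combination 2 * Complex.sinh (cylExp q z + g z) * Complex.sinh (cylExp q z) * hs)
  have hreal : ∀ z, ‖z‖ = 1 → conj (p z) = p z := by
    intro z hz
    have hz' : z ∈ sphere (0 : ℂ) 1 := by simpa using hz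
    obtain ⟨a1, a2, -⟩ := specialUnitary_entries (hGu z hz')
    obtain ⟨b1, b2, -⟩ := specialUnitary_entries (hKu z hz')
    rw [hpT z (hr1.trans hz.ge) hz.le]
    simp only [hT, a1, a2, b1, b2, map_add, map_sub, map_mul, map_neg, Complex.conj_conj]
    ring
  have hconst := eq_const_of_conj_eq hp hreal
  have hg0 := IsOddPlus.extension_zero hr0 hodd hg hgf
  refine IsOddPlus.eq_zero_of_exp_eq_const hr0 hodd hg hgf (c := 1) fun z hz => ?_
  have h1 := hconst z (hz.le.trans hr1)
  rw [hpg z hz.le, hpg 0 (by simpa using hr0.le)] at h1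
  simp only [Function.comp, hg0, Complex.cosh, neg_zero, Complex.exp_zero] at h1
  -- cosh g = 1 says that (exp g - 1)² = 0.
  have h2 : Complex.exp (g z) * Complex.exp (-g z) = 1 := by rw [← Complex.exp_add]; simp
  have h3 : (Complex.exp (g z) - 1) ^ 2 = 0 := by
    linear_combination Complex.exp (g z) * h1 - h2
  exact sub_eq_zero.1 (pow_eq_zero_iff two_ne_zero |>.1 h3)

/-! ### From (iii) to (ii) -/

theorem differentiable_polynomial_eval (p : Polynomial ℂ) : Differentiable ℂ fun z => p.eval z :=
  p.differentiable

/-- If `T ^ 2 = D ^ 2 * u` on `ℂ^*` with a polynomial `D`, then `D` divides `T` holomorphically. -/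
theorem exists_mul_eq_of_sq_eq (n : ℕ) : ∀ {D : Polynomial ℂ} {T u : ℂ → ℂ}, D.natDegree = n →
    D ≠ 0 → DifferentiableOn ℂ T {0}ᶜ → DifferentiableOn ℂ u {0}ᶜ →
    (∀ z, z ≠ 0 → T z ^ 2 = D.eval z ^ 2 * u z) →
    ∃ S : ℂ → ℂ, DifferentiableOn ℂ S {0}ᶜ ∧ (∀ z, z ≠ 0 → T z = D.eval z * S z) ∧
      ∀ z, z ≠ 0 → S z ^ 2 = u z := by
  induction n with
  | zero =>
    intro D T u hn hD hT hu h
    obtain ⟨c, rfl⟩ := Polynomial.natDegree_eq_zero.1 hn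
    have hc : c ≠ 0 := by simpa using hD
    simp only [Polynomial.eval_C] at h ⊢
    refine ⟨fun z => T z / c, hT.div_const c, fun z _ => by field_simp, fun z hz => ?_⟩
    rw [div_pow, h z hz]
    field_simp
  | succ n ih =>
    intro D T u hn hD hT hu h
    obtain ⟨a, ha⟩ := IsAlgClosed.exists_root D (by
      rw [Polynomial.degree_eq_natDegree hD, hn]; exact_mod_cast n.succ_ne_zero)
    obtain ⟨D', rfl⟩ := Polynomial.dvd_iff_isRoot.2 ha
    have hD' : D' ≠ 0 := right_ne_zero_of_mul hD
    have hn' : D'.natDegree = n := by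
      rw [Polynomial.natDegree_mul (Polynomial.X_sub_C_ne_zero a) hD',
        Polynomial.natDegree_X_sub_C] at hn
      omega
    obtain ⟨T', hT'd, hT'⟩ : ∃ T' : ℂ → ℂ, DifferentiableOn ℂ T' {0}ᶜ ∧
        ∀ z, z ≠ 0 → T z = (z - a) * T' z := by
      -- A root at 0 lies outside ℂ^*, where division by z is harmless; at any other root T
      -- vanishes.
      rcases eq_or_ne a 0 with rfl | ha0
      · refine ⟨fun z => T z / z, hT.div differentiableOn_id fun z hz => hz, fun z hz => ?_⟩
        field_simp
        ring
      · have hTa : T a = 0 := by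
          have := h a ha0
          rw [Polynomial.IsRoot.def.1 ha] at this
          simpa using this
        refine ⟨dslope T a, (Complex.differentiableOn_dslope
          (isOpen_compl_singleton.mem_nhds ha0)).2 hT, fun z _ => ?_⟩
        have := sub_smul_dslope T a z
        rw [hTa, sub_zero, smul_eq_mul] at this
        exact this.symm
    obtain ⟨S, hSd, hS1, hS2⟩ := ih hn' hD' hT'd hu
      -- The factor (z - a)² can be cancelled on a circle avoiding a; the identity theorem then
      -- covers ℂ^*.
      (eq_of_eq_on_sphere (r := ‖a‖ + 1) (by positivity) (hT'd.pow 2)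
        (((differentiable_polynomial_eval D').differentiableOn.pow 2).mul hu) fun z hz => by
          have hz0 : z ≠ 0 := norm_pos_iff.1 (by rw [hz]; positivity)
          have hza : z - a ≠ 0 := by
            intro h0
            rw [sub_eq_zero.1 h0] at hz
            linarith
          have h1 := h z hz0
          rw [hT' z hz0, Polynomial.eval_mul, Polynomial.eval_sub, Polynomial.eval_X,
            Polynomial.eval_C] at h1
          refine mul_left_cancel₀ (pow_ne_zero 2 hza) ?_
          linear_combination h1)
    refine ⟨S, hSd, fun z hz => ?_, hS2⟩
    rw [hT' z hz, hS1 z hz, Polynomial.eval_mul, Polynomial.eval_sub, Polynomial.eval_X,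
      Polynomial.eval_C, mul_assoc]

theorem exists_common_denominator {r : ℝ} {g : Loop r} (hg : IsRationalWithSimplePoles g) :
    ∃ (D : Polynomial ℂ) (N : Fin 2 → Fin 2 → Polynomial ℂ),
      (∀ μ : Circ r, D.eval (μ : ℂ) ≠ 0) ∧
      ∀ i j (μ : Circ r), (N i j).eval (μ : ℂ) = D.eval (μ : ℂ) * g μ i j := by
  obtain ⟨R, hR⟩ := hg
  have hdvd : ∀ i j, (R i j).denom ∣ ∏ k, ∏ l, (R k l).denom := fun i j =>
    (Finset.dvd_prod_of_mem (fun l => (R i l).denom) (Finset.mem_univ j)).trans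
      (Finset.dvd_prod_of_mem (fun k => ∏ l, (R k l).denom) (Finset.mem_univ i))
  choose e he using hdvd
  refine ⟨∏ k, ∏ l, (R k l).denom, fun i j => (R i j).num * e i j, fun μ => ?_, fun i j μ => ?_⟩
  · simp only [Polynomial.eval_prod]
    exact Finset.prod_ne_zero_iff.2 fun i _ => Finset.prod_ne_zero_iff.2 fun j _ =>
      ((hR i j).2 μ).1
  · obtain ⟨h1, h2⟩ := (hR i j).2 μ
    rw [he i j, h2, Polynomial.eval_mul, Polynomial.eval_mul]
    field_simp

theorem norm_exp_neg_cylExp (q : ℂ) {z : ℂ} (hz : ‖z‖ = 1) :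
    ‖Complex.exp (-cylExp q z)‖ = 1 := by
  have h := congrArg Complex.re (conj_cylExp q hz)
  simp only [Complex.conj_re, Complex.neg_re] at h
  rw [Complex.norm_exp, Complex.neg_re, ← h, show (cylExp q z).re = 0 by linarith, Real.exp_zero]

/-- The eigenvalue `c + s` of a special unitary matrix with half-trace `c` has modulus one. -/
theorem norm_add_eq_one_of_specialUnitary {U : Mat2} (hU : U ∈ specialUnitaryGroup (Fin 2) ℂ)
    {c s : ℂ} (hc : c = (U 0 0 + U 1 1) / 2) (hs : s ^ 2 = c ^ 2 - 1) : ‖c + s‖ = 1 := by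
  obtain ⟨h1, -, h3⟩ := specialUnitary_entries hU
  have hcre : c = ((U 0 0).re : ℂ) := by
    rw [hc, h1, Complex.add_conj]
    push_cast
    ring
  set x := (U 0 0).re with hx
  have hx1 : x ^ 2 ≤ 1 := by
    have h4 := congrArg Complex.re h3
    simp only [Complex.mul_conj, ← Complex.ofReal_add, Complex.ofReal_re, Complex.one_re,
      Complex.normSq_apply] at h4
    nlinarith [mul_self_nonneg (U 0 0).im, mul_self_nonneg (U 0 1).re,
      mul_self_nonneg (U 0 1).im]
  have hre := congrArg Complex.re hs
  have him := congrArg Complex.im hs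
  rw [hcre] at hre him
  simp only [pow_two, Complex.mul_re, Complex.mul_im, Complex.sub_re, Complex.sub_im,
    Complex.ofReal_re, Complex.ofReal_im, Complex.one_re, Complex.one_im] at hre him
  -- c is real with c² ≤ 1, so s² ≤ 0 and s is imaginary; then |c + s|² = c² - s² = 1.
  have hsre : s.re = 0 := by
    have h5 : s.re * s.im = 0 := by linarith
    rcases mul_eq_zero.1 h5 with h6 | h6
    · exact h6
    · rw [h6] at hre
      nlinarith
  have hsq : ‖c + s‖ ^ 2 = 1 := by
    rw [← Complex.normSq_eq_norm_sq, Complex.normSq_apply, hcre]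
    simp only [Complex.add_re, Complex.add_im, Complex.ofReal_re, Complex.ofReal_im, hsre]
    rw [hsre] at hre
    linarith
  exact (pow_eq_one_iff_of_nonneg (norm_nonneg _) two_ne_zero).1 hsq

theorem eq_zero_of_isRational {r : ℝ} (hr0 : 0 < r) (hr1 : r ≤ 1) {q : ℂ}
    {h : Loop r} (hh : ∀ μ, (h μ).det = 1) {f : Circ r → ℂ} (hf : IsOddPlus f)
    (hunit : h * cylinderMonodromy r q * expLoop f * h⁻¹ ∈ LambdaCstarSU r)
    (hrat : IsRationalWithSimplePoles (h * (fun _ => matA) * h⁻¹)) : ∀ μ, f μ = 0 := by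
  obtain ⟨-, hodd, g, hg, hgf⟩ := hf
  obtain ⟨-, G, hGd, hGe, hGu⟩ := hunit
  obtain ⟨D, N, hD, hN⟩ := exists_common_denominator hrat
  have hD0 : D ≠ 0 := by
    rintro rfl
    exact hD ⟨r, by simp [abs_of_pos hr0]⟩ (by simp)
  set c : ℂ → ℂ := fun z => (G z 0 0 + G z 1 1) / 2 with hc
  -- With N = DM on C_r, half the trace of GN is D sinh(x+f), because M has trace 0 and M² = 1.
  set T : ℂ → ℂ := fun z => (G z 0 0 * (N 0 0).eval z + G z 0 1 * (N 1 0).eval z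
    + G z 1 0 * (N 0 1).eval z + G z 1 1 * (N 1 1).eval z) / 2 with hT
  have hcd : DifferentiableOn ℂ c {0}ᶜ := ((hGd 0 0).add (hGd 1 1)).div_const 2
  have hNd : ∀ i j, DifferentiableOn ℂ (fun z => (N i j).eval z) {0}ᶜ := fun i j =>
    (differentiable_polynomial_eval _).differentiableOn
  have hTd : DifferentiableOn ℂ T {0}ᶜ :=
    (((((hGd 0 0).mul (hNd 0 0)).add ((hGd 0 1).mul (hNd 1 0))).add
      ((hGd 1 0).mul (hNd 0 1))).add ((hGd 1 1).mul (hNd 1 1))).div_const 2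
  have hsph : ∀ z, ‖z‖ = r → c z = Complex.cosh (cylExp q z + g z) ∧
      T z = D.eval z * Complex.sinh (cylExp q z + g z) := by
    intro z hz
    have hz' : z ∈ sphere (0 : ℂ) r := by simpa using hz
    have e1 := hGe ⟨z, hz'⟩
    have e3 := hgf ⟨z, hz'⟩
    rw [monodromy_apply (hh _)] at e1
    have ht := conj_matA_trace (hh ⟨z, hz'⟩)
    have hs := conj_matA_sq (hh ⟨z, hz'⟩)
    have hN' : ∀ i j, (N i j).eval z
        = D.eval z * (h ⟨z, hz'⟩ * matA * (h ⟨z, hz'⟩)⁻¹) i j := fun i j => hN i j ⟨z, hz'⟩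
    simp only [← e3] at e1
    simp only at e1 ht hs e3
    simp only [hc, hT, e1, smul_one_add_smul_apply, ht, hN', if_true, Fin.reduceEq, if_false]
    constructor
    · ring
    · linear_combination D.eval z * Complex.sinh (cylExp q z + g z) * hs
  obtain ⟨S, hSd, hTS, hSS⟩ := exists_mul_eq_of_sq_eq _ (u := fun z => c z ^ 2 - 1) rfl hD0 hTd
    ((hcd.pow 2).sub_const 1)
    (eq_of_eq_on_sphere hr0 (hTd.pow 2)
      (((differentiable_polynomial_eval D).differentiableOn.pow 2).mul
        ((hcd.pow 2).sub_const 1)) fun z hz => by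
        obtain ⟨h1, h2⟩ := hsph z hz
        have h3 := Complex.cosh_sq (cylExp q z + g z)
        simp only [h1, h2]
        rw [h3]
        ring)
  -- The two eigenvalues are mutually inverse, so c + S has no zeros on ℂ^*.
  have hE1 : ∀ z, z ≠ 0 → (c z + S z) * (c z - S z) = 1 := fun z hz => by
    linear_combination -hSS z hz
  set V : ℂ → ℂ := fun z => (c z + S z) * Complex.exp (-cylExp q z) with hV
  have hVd : DifferentiableOn ℂ V {0}ᶜ :=
    (hcd.add hSd).mul (differentiableOn_cylExp q).neg.cexp
  obtain ⟨p, hp, hpg, hpV⟩ := exists_diffContOnCl_glue_of_punctured hr0 hr1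
    (Complex.differentiable_exp.comp_diffContOnCl hg) hVd (fun z hz => by
      have hz' : z ∈ sphere (0 : ℂ) r := by simpa using hz
      obtain ⟨h1, h2⟩ := hsph z hz
      have h3 := hTS z (norm_pos_iff.1 (hz.symm ▸ hr0))
      rw [h2] at h3
      have h4 := mul_left_cancel₀ (hD ⟨z, hz'⟩) h3
      simp only [Function.comp, hV, h1, ← h4]
      rw [Complex.cosh_add_sinh, ← Complex.exp_add]
      ring_nf)
  have hconst := eq_const_of_norm_eq_one hp (fun z hz => by
      rcases le_total ‖z‖ r with h1 | h1
      · rw [hpg z h1]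
        exact Complex.exp_ne_zero _
      · rw [hpV z h1 hz]
        exact mul_ne_zero
          (left_ne_zero_of_mul_eq_one (hE1 z (norm_pos_iff.1 (hr0.trans_le h1))))
          (Complex.exp_ne_zero _)) (fun z hz => by
      have hz0 : z ≠ 0 := norm_pos_iff.1 (hz.symm ▸ one_pos)
      rw [hpV z (hr1.trans hz.ge) hz.le, hV, norm_mul, norm_exp_neg_cylExp q hz, mul_one]
      exact norm_add_eq_one_of_specialUnitary (hGu z (by simpa using hz)) rfl (hSS z hz0))
  refine IsOddPlus.eq_zero_of_exp_eq_const hr0 hodd hg hgf (c := p 0) fun z hz => ?_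
  rw [← hconst z (hz.le.trans hr1), hpg z hz.le]
  rfl

/-! ### Zeros of sinh x and removable quotients -/

theorem differentiableOn_sinh_cylExp (q : ℂ) :
    DifferentiableOn ℂ (fun z => Complex.sinh (cylExp q z)) {0}ᶜ :=
  (differentiableOn_cylExp q).csinh

theorem eventually_sinh_cylExp_ne_zero {q : ℂ} (hq : q ≠ 0) {a : ℂ} (ha : a ≠ 0) :
    ∀ᶠ z in 𝓝[≠] a, Complex.sinh (cylExp q z) ≠ 0 := by
  have han := analyticOnNhd_compl_zero (differentiableOn_sinh_cylExp q)
  refine (han a ha).eventually_eq_zero_or_eventually_ne_zero.resolve_left fun h0 => ?_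
  have hz := han.eqOn_zero_of_preconnected_of_eventuallyEq_zero isPreconnected_compl_zero ha h0
  have hn : (‖q‖ : ℂ) ≠ 0 := by exact_mod_cast norm_ne_zero_iff.2 hq
  -- A test point where the exponent is real and nonzero: |q|/2 - 2|q| = -(3/2)|q|.
  have hw : (2 * q / ‖q‖ : ℂ) ≠ 0 := div_ne_zero (mul_ne_zero two_ne_zero hq) hn
  have h1 : Complex.sinh (cylExp q (2 * q / ‖q‖)) = 0 := hz hw
  have h2 : cylExp q (2 * q / ‖q‖) = ((-(3 / 2) * ‖q‖ : ℝ) : ℂ) := by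
    have h3 : conj q * q = (‖q‖ : ℂ) ^ 2 := Complex.conj_mul' q
    unfold cylExp
    push_cast
    field_simp
    linear_combination (-4) * h3
  rw [h2, ← Complex.ofReal_sinh, Complex.ofReal_eq_zero, Real.sinh_eq_zero] at h1
  have := norm_pos_iff.2 hq
  linarith

theorem finite_sinh_cylExp_zeros {q : ℂ} (hq : q ≠ 0) {r R : ℝ} (hr : 0 < r) :
    {z : ℂ | (r ≤ ‖z‖ ∧ ‖z‖ ≤ R) ∧ Complex.sinh (cylExp q z) = 0}.Finite := by
  by_contra hinf
  have hK : IsCompact {z : ℂ | r ≤ ‖z‖ ∧ ‖z‖ ≤ R} := by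
    refine (isCompact_closedBall (0 : ℂ) R).of_isClosed_subset
      ((isClosed_le continuous_const continuous_norm).inter
        (isClosed_le continuous_norm continuous_const)) fun z hz => ?_
    simpa using hz.2
  obtain ⟨a, ha, hacc⟩ := Set.Infinite.exists_accPt_of_subset_isCompact hinf hK fun z hz => hz.1
  have h1 := accPt_iff_frequently_nhdsNE.1 hacc
  have h2 := eventually_sinh_cylExp_ne_zero hq (norm_pos_iff.1 (hr.trans_le ha.1))
  obtain ⟨z, hz1, hz2⟩ := (h1.and_eventually h2).exists
  exact hz2 hz1.2

/-- At a zero of sinh, cosh is nonzero, and x' = -(q/a² + q̄) can vanish only if |a|² = 1. -/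
theorem deriv_sinh_cylExp_ne_zero {q : ℂ} (hq : q ≠ 0) {a : ℂ} (ha : a ≠ 0) (ha1 : ‖a‖ ≠ 1)
    (h0 : Complex.sinh (cylExp q a) = 0) :
    deriv (fun z => Complex.sinh (cylExp q z)) a ≠ 0 := by
  have hd : HasDerivAt (cylExp q) (q * (-(a ^ 2)⁻¹) - conj q * 1) a :=
    ((hasDerivAt_inv ha).const_mul q).sub ((hasDerivAt_id a).const_mul (conj q))
  rw [hd.csinh.deriv]
  refine mul_ne_zero (fun hc => ?_) fun h1 => ha1 ?_
  · have := Complex.cosh_sq (cylExp q a)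
    rw [h0, hc] at this
    norm_num at this
  · have h2 : q = -(conj q * a ^ 2) := by
      field_simp at h1
      linear_combination -h1
    have h3 := congrArg norm h2
    rw [norm_neg, norm_mul, RCLike.norm_conj, norm_pow] at h3
    have h4 : ‖a‖ ^ 2 = 1 := by
      have := norm_pos_iff.2 hq
      exact mul_left_cancel₀ this.ne' (by linarith)
    exact (pow_eq_one_iff_of_nonneg (norm_nonneg _) two_ne_zero).1 h4

theorem exists_analytic_quotient {K : Set ℂ} {Y S : ℂ → ℂ} (hY : AnalyticOnNhd ℂ Y K)
    (hS : AnalyticOnNhd ℂ S K) (hne : ∀ a ∈ K, ∀ᶠ z in 𝓝[≠] a, S z ≠ 0)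
    (hord : ∀ a ∈ K, 0 ≤ meromorphicOrderAt (Y / S) a) :
    ∃ φ : ℂ → ℂ, AnalyticOnNhd ℂ φ K ∧ ∀ a ∈ K, S a * φ a = Y a := by
  have hmer : MeromorphicOn (Y / S) K := fun a ha => (hY a ha).meromorphicAt.div
    (hS a ha).meromorphicAt
  have han : AnalyticOnNhd ℂ (toMeromorphicNFOn (Y / S) K) K := fun a ha =>
    (meromorphicNFOn_toMeromorphicNFOn (Y / S) K ha).meromorphicOrderAt_nonneg_iff_analyticAt.1
      (by rw [meromorphicOrderAt_toMeromorphicNFOn hmer ha]; exact hord a ha)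
  refine ⟨_, han, fun a ha => ?_⟩
  have h1 := ((hS a ha).continuousAt.mul (han a ha).continuousAt).tendsto.mono_left
    (nhdsWithin_le_nhds (s := {a}ᶜ))
  have h2 := (hY a ha).continuousAt.tendsto.mono_left (nhdsWithin_le_nhds (s := {a}ᶜ))
  refine tendsto_nhds_unique_of_eventuallyEq h1 h2 ?_
  filter_upwards [hmer.toMeromorphicNFOn_eq_self_on_nhdsNE ha, hne a ha] with z hz1 hz2
  simp only [Pi.mul_apply, hz1, Pi.div_apply]
  field_simp

/-- At a pole the modulus tends to infinity from every direction, so a bound along a mere curve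
through a excludes one. -/
theorem meromorphicOrderAt_nonneg_of_frequently_le {Y S : ℂ → ℂ} {a : ℂ} {C : ℝ}
    (hmer : MeromorphicAt (Y / S) a) (hne : ∀ᶠ z in 𝓝[≠] a, S z ≠ 0)
    (hle : ∃ᶠ z in 𝓝[≠] a, ‖Y z‖ ≤ C * ‖S z‖) : 0 ≤ meromorphicOrderAt (Y / S) a := by
  by_contra hlt
  have h1 := tendsto_norm_atTop_iff_cobounded.2
    ((tendsto_cobounded_iff_meromorphicOrderAt_neg hmer).2 (not_le.1 hlt))
  obtain ⟨z, hz1, hz2, hz3⟩ :=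
    (hle.and_eventually (hne.and (h1.eventually_gt_atTop C))).exists
  rw [Pi.div_apply, norm_div, lt_div_iff₀ (norm_pos_iff.2 hz2)] at hz3
  exact hz3.not_ge hz1

theorem meromorphicOrderAt_nonneg_of_simple_zero {Y S : ℂ → ℂ} {a : ℂ} (hY : AnalyticAt ℂ Y a)
    (hS : AnalyticAt ℂ S a) (hY0 : Y a = 0) (hS0 : S a = 0) (hS' : deriv S a ≠ 0) :
    0 ≤ meromorphicOrderAt (Y / S) a := by
  refine (tendsto_nhds_iff_meromorphicOrderAt_nonneg
    (hY.meromorphicAt.div hS.meromorphicAt)).1 ⟨deriv Y a / deriv S a, ?_⟩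
  have h1 := hasDerivAt_iff_tendsto_slope.1 hY.differentiableAt.hasDerivAt
  have h2 := hasDerivAt_iff_tendsto_slope.1 hS.differentiableAt.hasDerivAt
  refine (h1.div h2 hS').congr' ?_
  filter_upwards [self_mem_nhdsWithin] with z hz
  have hza : z - a ≠ 0 := sub_ne_zero.2 hz
  simp only [slope_def_field, hY0, hS0, sub_zero, Pi.div_apply]
  exact div_div_div_cancel_right₀ hza _ _

/-- An entry `m` of `h A h⁻¹`, multiplied by a polynomial killing the poles, extends to the unit
disc; here `n` is the corresponding entry of `sinh(cylExp) h A h⁻¹`. -/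
theorem exists_diffContOnCl_mul {r : ℝ} (hr0 : 0 < r) (hr1 : r ≤ 1) {q : ℂ} (hq : q ≠ 0)
    {P : Polynomial ℂ}
    (hP : ∀ a, r < ‖a‖ → ‖a‖ < 1 → Complex.sinh (cylExp q a) = 0 → P.eval a = 0) {n m : ℂ → ℂ}
    (hn : DifferentiableOn ℂ n {0}ᶜ) (hm : DiffContOnCl ℂ m (ball 0 r))
    (hnm : ∀ z, ‖z‖ = r → n z = Complex.sinh (cylExp q z) * m z)
    (hle : ∀ z, ‖z‖ = 1 → ‖n z‖ ≤ ‖Complex.sinh (cylExp q z)‖) :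
    ∃ p, DiffContOnCl ℂ p (ball 0 1) ∧ (∀ z, ‖z‖ ≤ r → p z = P.eval z * m z) ∧
      ∀ z, ‖z‖ = 1 → Complex.sinh (cylExp q z) * p z = P.eval z * n z := by
  set S : ℂ → ℂ := fun z => Complex.sinh (cylExp q z) with hSdef
  set Y : ℂ → ℂ := fun z => P.eval z * n z with hYdef
  set K : Set ℂ := {z | r ≤ ‖z‖ ∧ ‖z‖ ≤ 1} with hKdef
  have hPd := differentiable_polynomial_eval P
  have hK : K ⊆ {0}ᶜ := fun z hz => norm_pos_iff.1 (hr0.trans_le hz.1)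
  have hSa : AnalyticOnNhd ℂ S K :=
    (analyticOnNhd_compl_zero (differentiableOn_sinh_cylExp q)).mono hK
  have hYa : AnalyticOnNhd ℂ Y K :=
    (analyticOnNhd_compl_zero (hPd.differentiableOn.mul hn)).mono hK
  have hne : ∀ a ∈ K, ∀ᶠ z in 𝓝[≠] a, S z ≠ 0 := fun a ha =>
    eventually_sinh_cylExp_ne_zero hq (hK ha)
  have hPm : DiffContOnCl ℂ (fun z => P.eval z * m z) (ball 0 r) := hPd.diffContOnCl.smul hm
  have hPmc : ContinuousOn (fun z => P.eval z * m z) (sphere 0 r) :=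
    hPm.continuousOn_ball.mono sphere_subset_closedBall
  have hord : ∀ a ∈ K, 0 ≤ meromorphicOrderAt (Y / S) a := by
    intro a ha
    have hmer := (hYa a ha).meromorphicAt.div (hSa a ha).meromorphicAt
    rcases ha.1.eq_or_lt with har | har
    -- On the inner circle the quotient is the bounded function P · m.
    · obtain ⟨C, hC⟩ := (isCompact_sphere (0 : ℂ) r).exists_bound_of_continuousOn hPmc
      refine meromorphicOrderAt_nonneg_of_frequently_le (C := C) hmer (hne a ha)
        ((frequently_sphere hr0 har.symm).mono fun z hz => ?_)
      have := hC z (by simpa using hz)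
      calc ‖Y z‖ = ‖P.eval z * m z‖ * ‖S z‖ := by
            rw [← norm_mul, hYdef]
            simp only [hnm z hz, hSdef]
            ring_nf
        _ ≤ C * ‖S z‖ := mul_le_mul_of_nonneg_right this (norm_nonneg _)
    rcases ha.2.eq_or_lt with ha1 | ha1
    -- On S¹ the bound on n takes care of zeros of any multiplicity.
    · obtain ⟨C, hC⟩ := (isCompact_sphere (0 : ℂ) 1).exists_bound_of_continuousOn
        hPd.continuous.continuousOn
      refine meromorphicOrderAt_nonneg_of_frequently_le (C := C) hmer (hne a ha)
        ((frequently_sphere one_pos ha1).mono fun z hz => ?_)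
      have := hC z (by simpa using hz)
      rw [hYdef]
      simp only [norm_mul]
      exact mul_le_mul this (hle z hz) (norm_nonneg _) ((norm_nonneg _).trans this)
    by_cases h0 : S a = 0
    · exact meromorphicOrderAt_nonneg_of_simple_zero (hYa a ha) (hSa a ha)
        (by simp [hYdef, hP a har ha1 h0]) h0 (deriv_sinh_cylExp_ne_zero hq (hK ha) ha1.ne h0)
    · exact ((hYa a ha).div (hSa a ha) h0).meromorphicOrderAt_nonneg
  obtain ⟨φ, hφ, hSφ⟩ := exists_analytic_quotient hYa hSa hne hord
  have hagree := eq_of_mul_eq_on_sphere hr0 (S := S)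
    (fun a ha => hne a ⟨ha.ge, ha.le.trans hr1⟩) hPmc
    (hφ.continuousOn.mono fun z hz => by
      have : ‖z‖ = r := by simpa using hz
      exact ⟨this.ge, this.le.trans hr1⟩) (fun z hz => by
      rw [hSφ z ⟨hz.ge, hz.le.trans hr1⟩, hYdef]
      simp only [hnm z hz, hSdef]
      ring)
  obtain ⟨p, hp, hp1, hp2⟩ := exists_diffContOnCl_glue hr0 hr1 hPm hφ.continuousOn
    (hφ.differentiableOn.mono fun z hz => ⟨hz.1.le, hz.2.le⟩) hagree
  refine ⟨p, hp, hp1, fun z hz => ?_⟩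
  rw [hp2 z (hr1.trans hz.ge) hz.le]
  exact hSφ z ⟨hr1.trans hz.ge, hz.le⟩

/-! ### From (i) to (iii) by reflection -/

/-- The polynomial of a finite set that is symmetric with respect to the unit circle. -/
theorem exists_pow_mul_conj_eval_prod {W : Finset ℂ} (h0 : ∀ b ∈ W, b ≠ 0)
    (hsymm : ∀ b ∈ W, (conj b)⁻¹ ∈ W) : ∃ κ : ℂ, κ ≠ 0 ∧ ∀ z, ‖z‖ = 1 →
      z ^ W.card * conj ((∏ b ∈ W, (Polynomial.X - Polynomial.C b)).eval z)
        = κ * (∏ b ∈ W, (Polynomial.X - Polynomial.C b)).eval z := by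
  refine ⟨∏ b ∈ W, -conj b, Finset.prod_ne_zero_iff.2 fun b hb => by simpa using h0 b hb,
    fun z hz => ?_⟩
  have hzz : z * conj z = 1 := by simp [Complex.mul_conj, Complex.normSq_eq_norm_sq, hz]
  simp only [Polynomial.eval_prod, Polynomial.eval_sub, Polynomial.eval_X, Polynomial.eval_C,
    map_prod, map_sub]
  -- Reindexing by reflection matches the factors: z(conj z - conj b) = -conj b · (z - 1/conj b).
  have hre : ∏ b ∈ W, (z - b) = ∏ b ∈ W, (z - (conj b)⁻¹) := by
    refine Finset.prod_nbij' (fun b => (conj b)⁻¹) (fun b => (conj b)⁻¹) hsymm hsymm ?_ ?_ ?_ <;>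
      simp
  rw [hre, ← Finset.prod_const, ← Finset.prod_mul_distrib, ← Finset.prod_mul_distrib]
  refine Finset.prod_congr rfl fun b hb => ?_
  have hb' : conj b ≠ 0 := by simpa using h0 b hb
  field_simp
  linear_combination hzz

/-- The reduced denominator divides a product of distinct linear factors, and the degree bound
leaves no pole at infinity. -/
theorem hasOnlySimplePoles_div {W : Finset ℂ} {Q : Polynomial ℂ} (hQ : Q.natDegree ≤ W.card) :
    HasOnlySimplePoles (algebraMap (Polynomial ℂ) (RatFunc ℂ) Q /
      algebraMap (Polynomial ℂ) (RatFunc ℂ) (∏ b ∈ W, (Polynomial.X - Polynomial.C b))) := by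
  classical
  set P : Polynomial ℂ := ∏ b ∈ W, (Polynomial.X - Polynomial.C b) with hP
  have hP0 : P ≠ 0 := (Polynomial.monic_prod_X_sub_C _ _).ne_zero
  have hPdeg : P.natDegree = W.card := Polynomial.natDegree_finsetProd_X_sub_C_eq_card _ _
  set R := algebraMap (Polynomial ℂ) (RatFunc ℂ) Q / algebraMap (Polynomial ℂ) (RatFunc ℂ) P with hR
  refine ⟨fun a => ?_, ?_⟩
  · refine (Polynomial.rootMultiplicity_le_rootMultiplicity_of_dvd hP0
      (RatFunc.denom_div_dvd Q P) a).trans ?_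
    rw [← Polynomial.count_roots, hP, Polynomial.roots_prod_X_sub_C]
    exact Multiset.nodup_iff_count_le_one.1 W.nodup a
  · have hmul : R.num * P = Q * R.denom := (RatFunc.num_mul_eq_mul_denom_iff hP0).2 hR
    by_cases hQ0 : R.num = 0
    · simp [hQ0]
    have hQ1 : Q ≠ 0 := by
      rintro rfl
      simp [hP0, hQ0] at hmul
    have := congrArg Polynomial.natDegree hmul
    rw [Polynomial.natDegree_mul hQ0 hP0, Polynomial.natDegree_mul hQ1 R.denom_ne_zero] at this
    omega

theorem diffContOnCl_conj_matA {H : ℂ → Mat2} {s : Set ℂ}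
    (hH : ∀ i j, DiffContOnCl ℂ (fun z => H z i j) s) (i j : Fin 2) :
    DiffContOnCl ℂ (fun z => (H z * matA * (H z).adjugate) i j) s := by
  have hmul : ∀ i j k l, DiffContOnCl ℂ (fun z => H z i j * H z k l) s := fun i j k l =>
    (hH i j).smul (hH k l)
  have he : ∀ z, H z * matA * (H z).adjugate =
      !![H z 0 1 * H z 1 1 - H z 0 0 * H z 1 0, H z 0 0 * H z 0 0 - H z 0 1 * H z 0 1;
        H z 1 1 * H z 1 1 - H z 1 0 * H z 1 0, H z 0 0 * H z 1 0 - H z 0 1 * H z 1 1] := by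
    intro z
    ext i j
    fin_cases i <;> fin_cases j <;>
      simp [mul_apply, Fin.sum_univ_two, matA, adjugate_fin_two] <;> ring
  simp only [he]
  fin_cases i <;> fin_cases j
  · exact (hmul 0 1 1 1).sub (hmul 0 0 1 0)
  · exact (hmul 0 0 0 0).sub (hmul 0 1 0 1)
  · exact (hmul 1 1 1 1).sub (hmul 1 0 1 0)
  · exact (hmul 0 0 1 0).sub (hmul 0 1 1 1)

theorem conj_sinh_cylExp (q : ℂ) {z : ℂ} (hz : ‖z‖ = 1) :
    conj (Complex.sinh (cylExp q z)) = -Complex.sinh (cylExp q z) := by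
  rw [← Complex.sinh_conj, conj_cylExp q hz, Complex.sinh_neg]

theorem conj_cosh_cylExp (q : ℂ) {z : ℂ} (hz : ‖z‖ = 1) :
    conj (Complex.cosh (cylExp q z)) = Complex.cosh (cylExp q z) := by
  rw [← Complex.cosh_conj, conj_cylExp q hz, Complex.cosh_neg]

/-- The trace-free part of a special unitary matrix with half-trace `cosh x`, `x` imaginary, is
skew-Hermitian and bounded by `sinh x`. -/
theorem specialUnitary_sub_cosh {U : Mat2} (hU : U ∈ specialUnitaryGroup (Fin 2) ℂ) {c s : ℂ}
    (htr : U 0 0 + U 1 1 = 2 * c) (hc : conj c = c) (hs : conj s = -s) (hcs : c ^ 2 = s ^ 2 + 1)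
    (i j : Fin 2) :
    conj ((U - c • (1 : Mat2)) j i) = -(U - c • (1 : Mat2)) i j ∧
      ‖(U - c • (1 : Mat2)) i j‖ ≤ ‖s‖ := by
  obtain ⟨h1, h2, h3⟩ := specialUnitary_entries hU
  rw [h1] at htr
  -- One identity bounds both entries; it follows from det U = 1 and c² - s² = 1.
  have hsum : ‖U 0 0 - c‖ ^ 2 + ‖U 0 1‖ ^ 2 = ‖s‖ ^ 2 := by
    have : (U 0 0 - c) * conj (U 0 0 - c) + U 0 1 * conj (U 0 1) = s * conj s := by
      rw [map_sub, hc, hs]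
      linear_combination h3 - c * htr - hcs
    simp only [Complex.mul_conj'] at this
    exact_mod_cast this
  have hb0 : ‖U 0 0 - c‖ ≤ ‖s‖ :=
    abs_le_of_sq_le_sq' (by nlinarith [sq_nonneg ‖U 0 1‖]) (norm_nonneg _) |>.2
  have hb1 : ‖U 0 1‖ ≤ ‖s‖ :=
    abs_le_of_sq_le_sq' (by nlinarith [sq_nonneg ‖U 0 0 - c‖]) (norm_nonneg _) |>.2
  have h11 : conj (U 0 0) - c = conj (U 0 0 - c) := by rw [map_sub, hc]
  fin_cases i <;> fin_cases j <;>
    simp only [Fin.zero_eta, Fin.mk_one, Matrix.sub_apply, Matrix.smul_apply, Matrix.one_apply,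
      if_true, Fin.reduceEq, if_false, smul_eq_mul, mul_one, mul_zero, sub_zero, h1, h2, map_neg,
      map_sub, Complex.conj_conj, hc, neg_neg, norm_neg, RCLike.norm_conj, true_and]
  · exact ⟨by linear_combination htr, hb0⟩
  · exact hb1
  · exact hb1
  · rw [h11, RCLike.norm_conj]
    exact ⟨by rw [map_sub, hc]; linear_combination htr, hb0⟩

theorem isRational_of_cylinder_conj_mem {r : ℝ} (hr0 : 0 < r) (hr1 : r ≤ 1) {q : ℂ} (hq : q ≠ 0)
    {h : Loop r} (hh : h ∈ LambdaPlus r)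
    (hcyl : h * cylinderMonodromy r q * h⁻¹ ∈ LambdaCstarSU r) :
    IsRationalWithSimplePoles (h * (fun _ => matA) * h⁻¹) := by
  classical
  obtain ⟨⟨-, hdet, -⟩, H, hHd, hHe⟩ := hh
  obtain ⟨-, G, hGd, hGe, hGu⟩ := hcyl
  set C : ℂ → ℂ := fun z => Complex.cosh (cylExp q z) with hC
  have hCd : DifferentiableOn ℂ C {0}ᶜ := (differentiableOn_cylExp q).ccosh
  set n : Fin 2 → Fin 2 → ℂ → ℂ := fun i j z => (G z - C z • (1 : Mat2)) i j with hn
  set m : Fin 2 → Fin 2 → ℂ → ℂ := fun i j z => (H z * matA * (H z).adjugate) i j with hm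
  have hnd : ∀ i j, DifferentiableOn ℂ (n i j) {0}ᶜ := fun i j =>
    (hGd i j).sub (hCd.mul_const _)
  have hmd : ∀ i j, DiffContOnCl ℂ (m i j) (ball 0 r) := diffContOnCl_conj_matA hHd
  have hmM : ∀ i j (μ : Circ r), m i j μ = (h μ * matA * (h μ)⁻¹) i j := fun i j μ => by
    simp only [hm]
    rw [hHe μ, conj_matA_eq (hdet μ)]
  have hnm : ∀ i j z, ‖z‖ = r → n i j z = Complex.sinh (cylExp q z) * m i j z := by
    intro i j z hz
    have hz' : z ∈ sphere (0 : ℂ) r := by simpa using hz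
    have e1 := hGe ⟨z, hz'⟩
    have e2 := hmM i j ⟨z, hz'⟩
    rw [cylinder_conj_apply (hdet _)] at e1
    simp only at e1 e2
    simp only [hn, e1, e2, hC, add_sub_cancel_left, Matrix.smul_apply, smul_eq_mul]
  have htr : ∀ z, z ≠ 0 → G z 0 0 + G z 1 1 = 2 * C z :=
    eq_of_eq_on_sphere hr0 ((hGd 0 0).add (hGd 1 1)) (hCd.const_mul 2) fun z hz => by
      have hz' : z ∈ sphere (0 : ℂ) r := by simpa using hz
      have e1 := hGe ⟨z, hz'⟩
      rw [cylinder_conj_apply (hdet _)] at e1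
      have ht := conj_matA_trace (hdet ⟨z, hz'⟩)
      simp only at e1 ht
      simp only [e1, smul_one_add_smul_apply, ht, if_true, hC]
      ring
  have hskew : ∀ i j z, ‖z‖ = 1 →
      conj (n j i z) = -n i j z ∧ ‖n i j z‖ ≤ ‖Complex.sinh (cylExp q z)‖ := fun i j z hz =>
    specialUnitary_sub_cosh (hGu z (by simpa using hz))
      (htr z (norm_pos_iff.1 (hz.symm ▸ one_pos))) (conj_cosh_cylExp q hz)
      (conj_sinh_cylExp q hz) (Complex.cosh_sq _) i j
  have hfin : {z : ℂ | (r < ‖z‖ ∧ ‖z‖ < 1) ∧ Complex.sinh (cylExp q z) = 0}.Finite :=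
    (finite_sinh_cylExp_zeros hq hr0 (R := 1)).subset fun z hz =>
      ⟨⟨hz.1.1.le, hz.1.2.le⟩, hz.2⟩
  set Z : Finset ℂ := hfin.toFinset with hZ
  have hmemZ : ∀ b, b ∈ Z ↔ (r < ‖b‖ ∧ ‖b‖ < 1) ∧ Complex.sinh (cylExp q b) = 0 := fun b => by
    simp [hZ]
  -- Adding the mirror images, which lie outside the closed unit disc, makes P self-reciprocal up to
  -- the constant κ.
  set W : Finset ℂ := Z ∪ Z.image (fun b => (conj b)⁻¹) with hW
  have hWr : ∀ b ∈ W, r < ‖b‖ := by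
    intro b hb
    rcases Finset.mem_union.1 hb with hb | hb
    · exact ((hmemZ b).1 hb).1.1
    · obtain ⟨b', hb', rfl⟩ := Finset.mem_image.1 hb
      obtain ⟨⟨h1, h2⟩, -⟩ := (hmemZ b').1 hb'
      rw [norm_inv, RCLike.norm_conj]
      exact hr1.trans_lt ((one_lt_inv₀ (hr0.trans h1)).2 h2)
  have hWs : ∀ b ∈ W, (conj b)⁻¹ ∈ W := by
    intro b hb
    rcases Finset.mem_union.1 hb with hb | hb
    · exact Finset.mem_union_right _ (Finset.mem_image_of_mem _ hb)
    · obtain ⟨b', hb', rfl⟩ := Finset.mem_image.1 hb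
      exact Finset.mem_union_left _ (by simpa using hb')
  obtain ⟨κ, hκ, hκP⟩ := exists_pow_mul_conj_eval_prod
    (fun b hb => norm_pos_iff.1 (hr0.trans (hWr b hb))) hWs
  set P : Polynomial ℂ := ∏ b ∈ W, (Polynomial.X - Polynomial.C b) with hP
  have hPev : ∀ z, P.eval z = ∏ b ∈ W, (z - b) := fun z => by simp [hP, Polynomial.eval_prod]
  have hPz : ∀ a, r < ‖a‖ → ‖a‖ < 1 → Complex.sinh (cylExp q a) = 0 → P.eval a = 0 := by
    intro a h1 h2 h3
    rw [hPev]
    exact Finset.prod_eq_zero (Finset.mem_union_left _ ((hmemZ a).2 ⟨⟨h1, h2⟩, h3⟩))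
      (sub_self a)
  have hPr : ∀ μ : Circ r, P.eval (μ : ℂ) ≠ 0 := by
    intro μ
    rw [hPev]
    refine Finset.prod_ne_zero_iff.2 fun b hb => sub_ne_zero.2 fun hμ => (hWr b hb).ne ?_
    rw [← hμ, mem_sphere_zero_iff_norm.1 μ.2]
  choose p hpd hpm hpS using fun i j =>
    exists_diffContOnCl_mul hr0 hr1 hq hPz (hnd i j) (hmd i j) (hnm i j)
      (fun z hz => (hskew i j z hz).2)
  -- On S¹ both n and sinh x are skew, so their quotient M is Hermitian. Since sinh x may vanish
  -- there, the relation is proved after multiplying by it.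
  have hrefl : ∀ i j z, ‖z‖ = 1 → κ * p i j z = z ^ W.card * conj (p j i z) := by
    intro i j
    have hpc : ∀ i j, ContinuousOn (p i j) (sphere 0 1) := fun i j =>
      (hpd i j).continuousOn_ball.mono sphere_subset_closedBall
    refine eq_of_mul_eq_on_sphere one_pos (S := fun z => Complex.sinh (cylExp q z))
      (fun a ha => eventually_sinh_cylExp_ne_zero hq (norm_pos_iff.1 (ha.symm ▸ one_pos)))
      (continuousOn_const.mul (hpc i j))
      ((continuous_pow _).continuousOn.mul
        (Complex.continuous_conj.comp_continuousOn (hpc j i))) fun z hz => ?_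
    have h1 := hpS i j z hz
    have h2 := congrArg conj (hpS j i z hz)
    rw [map_mul, map_mul, conj_sinh_cylExp q hz, (hskew i j z hz).1] at h2
    linear_combination κ * h1 + z ^ W.card * h2 - n i j z * hκP z hz
  have hpoly : ∀ i j, ∃ Q : Polynomial ℂ, Q.natDegree ≤ W.card ∧
      ∀ z, ‖z‖ ≤ 1 → p i j z = Q.eval z := fun i j =>
    exists_polynomial_of_eq_pow_mul_conj W.card (hpd i j) ((hpd j i).const_smul (conj κ)⁻¹)
      fun z hz => by
        have := hrefl i j z hz
        simp only [Pi.smul_apply, smul_eq_mul, map_mul, map_inv₀, Complex.conj_conj]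
        field_simp
        linear_combination this
  choose Q hQd hQe using hpoly
  refine ⟨fun i j => algebraMap (Polynomial ℂ) (RatFunc ℂ) (Q i j) / algebraMap _ _ P,
    fun i j => ⟨hasOnlySimplePoles_div (hQd i j), fun μ => ?_⟩⟩
  have hμ := mem_sphere_zero_iff_norm.1 μ.2
  have hPμ := hPr μ
  have hP0 : P ≠ 0 := (Polynomial.monic_prod_X_sub_C _ _).ne_zero
  set R := algebraMap (Polynomial ℂ) (RatFunc ℂ) (Q i j) / algebraMap _ _ P with hR
  have hmul := congrArg (Polynomial.eval (μ : ℂ)) ((RatFunc.num_mul_eq_mul_denom_iff hP0).2 hR)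
  have hden : R.denom.eval (μ : ℂ) ≠ 0 := by
    obtain ⟨e, he⟩ := RatFunc.denom_div_dvd (Q i j) P
    rw [he, Polynomial.eval_mul] at hPμ
    exact left_ne_zero_of_mul hPμ
  have hval : P.eval (μ : ℂ) * m i j μ = (Q i j).eval (μ : ℂ) := by
    rw [← hQe i j μ (hμ.le.trans hr1), hpm i j μ hμ.le]
  rw [hmM] at hval
  rw [Polynomial.eval_mul, Polynomial.eval_mul] at hmul
  refine ⟨hden, ?_⟩
  change (h μ * matA * (h μ)⁻¹) i j = _
  rw [eq_div_iff hden]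
  refine mul_left_cancel₀ hPμ ?_
  linear_combination R.denom.eval (μ : ℂ) * hval - hmul

end LoopDressing

theorem mainTheorem7 (r : ℝ) (hr0 : 0 < r) (hr1 : r ≤ 1) (q : ℂ) (hq : q ≠ 0)
    (h : LoopDressing.Loop r) (hh : h ∈ LoopDressing.LambdaPlus r)
    (F : ℂ → LoopDressing.Loop r)
    (hF : LoopDressing.IsDressing h (LoopDressing.cylinderFrame r) F)
    (f : LoopDressing.Circ r → ℂ) (hf : LoopDressing.IsOddPlus f)
    (hmon : LoopDressing.IsMonodromy F q
      (h * LoopDressing.cylinderMonodromy r q * LoopDressing.expLoop f * h⁻¹))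
    (hunit : h * LoopDressing.cylinderMonodromy r q * LoopDressing.expLoop f * h⁻¹ ∈
      LoopDressing.LambdaCstarSU r) :
    List.TFAE
      [h * LoopDressing.cylinderMonodromy r q * h⁻¹ ∈ LoopDressing.LambdaCstarSU r,
        ∀ μ, f μ = 0,
        LoopDressing.IsRationalWithSimplePoles
          (h * (fun _ => LoopDressing.matA) * h⁻¹)] := by
  have h21 : (∀ μ, f μ = 0) →
      h * LoopDressing.cylinderMonodromy r q * h⁻¹ ∈ LoopDressing.LambdaCstarSU r := fun h0 => by
    rwa [LoopDressing.expLoop_eq_one h0, mul_one] at hunit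
  tfae_have 1 → 2 := LoopDressing.eq_zero_of_cylinder_conj_mem hr0 hr1 hh.1.2.1 hf hunit
  tfae_have 2 → 1 := h21
  tfae_have 2 → 3 := fun h0 =>
    LoopDressing.isRational_of_cylinder_conj_mem hr0 hr1 hq hh (h21 h0)
  tfae_have 3 → 2 := LoopDressing.eq_zero_of_isRational hr0 hr1 hh.1.2.1 hf hunit
  tfae_finish
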